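/- For $p\in(0,1)$ let $\mu_p$ be the product measure on $\{0,1\}^n$ with $\mu_p(x)=p^{\sum_i x_i}(1-p)^{\sum_i(1-x_i)}$. Say that $g,h\colon\{0,1\}^n\to\mathbb{R}$ are $\delta$-close with respect to $\mu_p$ if $\mathbb{E}_{x\sim\mu_p}[(g(x)-h(x))^2]\le\delta$. An affine function is a function of the form $x\mapsto c_0+\sum_{i=1}^n c_i x_i$ with real $c_0,\dots,c_n$. By convention $\max_{i\in\emptyset}x_i=0$ and $\min_{i\in\emptyset}x_i=1$. There is an absolute constant $C>0$ such that the following holds for all integers $n\ge 0$, all $p\in(0,1)$ and all real $\epsilon$. Suppose $f\colon\{0,1\}^n\to\{0,1\}$ is $\epsilon$-close to some affine function with respect to $\mu_p$ (so that $\epsilon\ge0$). Then there is a set $S\subseteq\{1,\dots,n\}$ with \[ |S|\le\max\Bigl(1,\ C\,\frac{\sqrt{\epsilon}}{\min(p,1-p)}\Bigr) \] such that: if $p\le 1/2$, then $f$ or $1-f$ is $C\epsilon$-close to $\max_{i\in S}x_i$ with respect to $\mu_p$; if $p>1/2$, then $f$ or $1-f$ is $C\epsilon$-close to $\min_{i\in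 S}x_i$ with respect to $\mu_p$. -/

import Mathlib

namespace BiasedCube

/-- The Boolean cube `{0,1}ⁿ`, with `false` standing for `0` and `true` for `1`. -/
abbrev Cube (n : ℕ) : Type := Fin n → Bool

/-- The real value `0` or `1` of a bit. -/
def bitVal (b : Bool) : ℝ := if b = true then 1 else 0

/-- A Boolean function on the cube, regarded as a real-valued function. -/
def boolFun {n : ℕ} (f : Cube n → Bool) : Cube n → ℝ := fun x => bitVal (f x)

/-- The value of the measure `μ_p` on the atom `x`:
`p` to the number of ones of `x`, times `1 - p` to the number of zeros of `x`. -/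
noncomputable def muP {n : ℕ} (p : ℝ) (x : Cube n) : ℝ :=
  p ^ (∑ i, (x i).toNat) * (1 - p) ^ (∑ i, (1 - (x i).toNat))

/-- The squared `L²` norm `E[g²]` with respect to `μ_p`. -/
noncomputable def normSq {n : ℕ} (p : ℝ) (g : Cube n → ℝ) : ℝ :=
  ∑ x, muP p x * g x ^ 2

/-- `g` and `h` are `ε`-close with respect to `μ_p`. -/
def IsClose {n : ℕ} (p ε : ℝ) (g h : Cube n → ℝ) : Prop :=
  normSq p (g - h) ≤ ε

/-- Affine functions `c₀ + ∑ cᵢ xᵢ` on the cube. -/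
def IsAffine {n : ℕ} (g : Cube n → ℝ) : Prop :=
  ∃ (c₀ : ℝ) (c : Fin n → ℝ), ∀ x, g x = c₀ + ∑ i, c i * bitVal (x i)

/-- The function `max_{i ∈ S} xᵢ`; it is `0` when `S` is empty. -/
noncomputable def maxVars {n : ℕ} (S : Finset (Fin n)) : Cube n → ℝ := boolFun fun x => S.sup x

/-- The function `min_{i ∈ S} xᵢ`; it is `1` when `S` is empty. -/
noncomputable def minVars {n : ℕ} (S : Finset (Fin n)) : Cube n → ℝ := boolFun fun x => S.inf x

end BiasedCube

/-!
Let `c₀ + ∑ cᵢ xᵢ` be an affine function `ε`-close to a Boolean function, and let `x`, `y` be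
independent. Resampling the coordinates in any set `I` shows that `∑_{i ∈ I} cᵢ (xᵢ - yᵢ)` is within
`O(ε)` in mean square of `{-1, 0, 1}`. This sum is a lazy random walk with steps `±cᵢ`, each taken
with probability `q = 2p(1 - p)`.

If all `|cᵢ| ≤ 1/2` on `I`, the fourth moment of the walk is controlled by its second moment `v`, so
that `v = O(ε) + O(v²)`; adding the indices one by one excludes large values of `v`, whence
`v = O(ε)`. On the set `G` of indices with `|cᵢ| > 1/2`, walks with two steps are bounded away from
`{-1, 0, 1}` unless `cᵢ` is bounded away from `±1`; adding the indices one by one again, this gives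
`|G| q ≤ 1/2` and `|G|(|G| - 1) q² = O(ε)`. Walks with one step then show that the `cᵢ` on `G` are
close to `±1`.

So the Boolean function is `O(ε)`-close to `a + ∑_{i ∈ G} ± xᵢ`. For `p ≤ 1/2` all variables in `G`
vanish with probability at least `1/2`, so `a` is near `0` or `1`, and two of them are equal to one
with probability `O(ε)`. Up to this event `a + ∑_{i ∈ G} ± xᵢ` determines the Boolean function: if
`a` is near `0`, it is the maximum of the `xᵢ` with sign `+`, and if `a` is near `1`, its negation
is the maximum of the `xᵢ` with sign `-`. The case `p > 1/2` follows by complementing the cube.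
-/

namespace BiasedCube

variable {n : ℕ} {p : ℝ}

/-! ### Expectations -/

/-- The expectation of `F` with respect to `μ_p`. -/
noncomputable def expect (p : ℝ) (F : Cube n → ℝ) : ℝ := ∑ x, muP p x * F x

theorem muP_eq_prod (x : Cube n) : muP p x = ∏ i, if x i then p else 1 - p := by
  simp only [muP, ← Finset.prod_pow_eq_pow_sum, ← Finset.prod_mul_distrib]
  refine Finset.prod_congr rfl fun i _ => ?_
  cases x i <;> simp

theorem muP_nonneg (hp : p ∈ Set.Icc 0 1) (x : Cube n) : 0 ≤ muP p x :=
  mul_nonneg (pow_nonneg hp.1 _) (pow_nonneg (sub_nonneg.2 hp.2) _)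

theorem expect_add (F G : Cube n → ℝ) :
    expect p (fun x => F x + G x) = expect p F + expect p G := by
  simp only [expect, mul_add, Finset.sum_add_distrib]

theorem expect_const_mul (a : ℝ) (F : Cube n → ℝ) :
    expect p (fun x => a * F x) = a * expect p F := by
  simp only [expect, Finset.mul_sum, mul_left_comm]

theorem expect_sum {ι : Type*} (s : Finset ι) (F : ι → Cube n → ℝ) :
    expect p (fun x => ∑ i ∈ s, F i x) = ∑ i ∈ s, expect p (F i) := by
  simp only [expect, Finset.mul_sum]
  exact Finset.sum_comm

theorem expect_mono (hp : p ∈ Set.Icc 0 1) {F G : Cube n → ℝ} (h : ∀ x, F x ≤ G x) :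
    expect p F ≤ expect p G :=
  Finset.sum_le_sum fun x _ => mul_le_mul_of_nonneg_left (h x) (muP_nonneg hp x)

theorem expect_prod (g : Fin n → Bool → ℝ) :
    expect p (fun x => ∏ i, g i (x i)) = ∏ i, (p * g i true + (1 - p) * g i false) := by
  calc expect p (fun x => ∏ i, g i (x i))
      = ∑ x : Cube n, ∏ i, (if x i then p else 1 - p) * g i (x i) := by
        simp only [expect, muP_eq_prod, Finset.prod_mul_distrib]
    _ = ∏ i, ∑ b : Bool, (if b then p else 1 - p) * g i b := by
        rw [Finset.prod_univ_sum, Fintype.piFinset_univ]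
    _ = ∏ i, (p * g i true + (1 - p) * g i false) := by
        simp only [Fintype.sum_bool, if_true, Bool.false_eq_true, if_false]

theorem expect_const (a : ℝ) : expect p (fun _ : Cube n => a) = a := by
  have total : expect p (fun _ : Cube n => 1) = 1 := by
    simpa using expect_prod (n := n) (p := p) fun _ _ => 1
  simpa [total] using expect_const_mul (p := p) a fun _ : Cube n => 1

theorem expect_apply (i : Fin n) (g : Bool → ℝ) :
    expect p (fun x => g (x i)) = p * g true + (1 - p) * g false := by
  have h := expect_prod (p := p) fun j b => if j = i then g b else 1
  rw [Finset.prod_eq_single i (fun j _ hj => by simp [hj]) (by simp)] at h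
  simpa using h

theorem expect_nonneg (hp : p ∈ Set.Icc 0 1) {F : Cube n → ℝ} (h : ∀ x, 0 ≤ F x) :
    0 ≤ expect p F :=
  Finset.sum_nonneg fun x _ => mul_nonneg (muP_nonneg hp x) (h x)

theorem exists_le_expect (hp : p ∈ Set.Icc 0 1) (F : Cube n → ℝ) : ∃ x, F x ≤ expect p F := by
  obtain ⟨x, hx⟩ := Finite.exists_min F
  exact ⟨x, (expect_const (p := p) (F x)).ge.trans (expect_mono hp hx)⟩

/-- Exchanging the coordinates in `I` between two independent points preserves their joint law. -/
theorem expect_expect_piecewise (I : Finset (Fin n)) (F : Cube n → ℝ) :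
    expect p (fun x => expect p fun y => F (I.piecewise y x)) = expect p F := by
  let swap (z : Cube n × Cube n) : Cube n × Cube n :=
    (I.piecewise z.2 z.1, I.piecewise z.1 z.2)
  have swap_swap : Function.Involutive swap := fun z => by
    ext i <;> by_cases hi : i ∈ I <;> simp [swap, hi]
  have muP_swap (z : Cube n × Cube n) :
      muP p (swap z).1 * muP p (swap z).2 = muP p z.1 * muP p z.2 := by
    simp only [muP_eq_prod, ← Finset.prod_mul_distrib]
    refine Finset.prod_congr rfl fun i _ => ?_
    by_cases hi : i ∈ I <;> simp [swap, hi, mul_comm]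
  calc expect p (fun x => expect p fun y => F (I.piecewise y x))
      = ∑ z, muP p z.1 * muP p z.2 * F (swap z).1 := by
        simp only [expect, Finset.mul_sum, ← mul_assoc, Fintype.sum_prod_type, swap]
    _ = ∑ z : Cube n × Cube n, muP p z.1 * muP p z.2 * F z.1 :=
        Fintype.sum_equiv swap_swap.toPerm _ _ fun z => by
          rw [← muP_swap z, Function.Involutive.coe_toPerm]
    _ = expect p (fun x => expect p fun _ : Cube n => F x) := by
        simp only [expect, Finset.mul_sum, ← mul_assoc, Fintype.sum_prod_type]
    _ = expect p F := by simp only [expect_const]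

theorem expect_eq_update (i : Fin n) (F : Cube n → ℝ) :
    expect p F = p * expect p (fun x => F (Function.update x i true)) +
      (1 - p) * expect p (fun x => F (Function.update x i false)) := by
  have resample (x : Cube n) : expect p (fun y => F (Function.update x i (y i))) =
      p * F (Function.update x i true) + (1 - p) * F (Function.update x i false) :=
    expect_apply i fun b => F (Function.update x i b)
  rw [← expect_expect_piecewise {i} F]
  simp only [Finset.piecewise_singleton, resample, expect_add, expect_const_mul]

theorem expect_bitVal (i : Fin n) : expect p (fun x => bitVal (x i)) = p := by
  rw [expect_apply i bitVal]
  simp [bitVal]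

theorem expect_bitVal_mul_bitVal {i j : Fin n} (hij : i ≠ j) :
    expect p (fun x => bitVal (x i) * bitVal (x j)) = p ^ 2 := by
  rw [expect_eq_update i]
  simp only [Function.update_self, Function.update_of_ne hij.symm, expect_const_mul, expect_bitVal]
  simp [bitVal, sq]

/-! ### Closeness -/

theorem IsClose.trans (hp : p ∈ Set.Icc 0 1) {δ η : ℝ} {g h k : Cube n → ℝ}
    (hgh : IsClose p δ g h) (hhk : IsClose p η h k) : IsClose p (2 * δ + 2 * η) g k :=
  calc expect p (fun x => (g x - k x) ^ 2)
      ≤ expect p (fun x => 2 * (g x - h x) ^ 2 + 2 * (h x - k x) ^ 2) :=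
        expect_mono hp fun x => by nlinarith [sq_nonneg ((g x - h x) - (h x - k x))]
    _ = 2 * normSq p (g - h) + 2 * normSq p (h - k) := by
        rw [expect_add, expect_const_mul, expect_const_mul]; rfl
    _ ≤ 2 * δ + 2 * η := by gcongr <;> assumption

theorem IsClose.mono {δ ε : ℝ} {g h : Cube n → ℝ} (hgh : IsClose p δ g h) (hδ : δ ≤ ε) :
    IsClose p ε g h :=
  le_trans hgh hδ

theorem IsClose.nonneg (hp : p ∈ Set.Icc 0 1) {ε : ℝ} {g h : Cube n → ℝ} (hgh : IsClose p ε g h) :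
    0 ≤ ε :=
  (expect_nonneg hp fun x => sq_nonneg ((g - h) x)).trans hgh

theorem bitVal_nonneg (b : Bool) : 0 ≤ bitVal b := by cases b <;> simp [bitVal]

theorem bitVal_not (b : Bool) : bitVal (!b) = 1 - bitVal b := by cases b <;> simp [bitVal]

theorem one_sub_boolFun (f : Cube n → Bool) : 1 - boolFun f = boolFun fun x => !f x :=
  funext fun x => (bitVal_not (f x)).symm

theorem isClose_boolFun_one (hp : p ∈ Set.Icc 0 1) (f g : Cube n → Bool) :
    IsClose p 1 (boolFun f) (boolFun g) :=
  calc expect p (fun x => (bitVal (f x) - bitVal (g x)) ^ 2)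
      ≤ expect p (fun _ => 1) :=
        expect_mono hp fun x => by cases f x <;> cases g x <;> simp [bitVal]
    _ = 1 := expect_const 1

/-! ### Symmetrised linear forms -/

/-- The linear form `∑_{i ∈ I} cᵢ xᵢ`, the part of an affine function carried by `I`. -/
noncomputable def linForm (c : Fin n → ℝ) (I : Finset (Fin n)) (x : Cube n) : ℝ :=
  ∑ i ∈ I, c i * bitVal (x i)

/-- The expectation `E[Φ(L x - L y)]` over independent `x, y ∼ μ_p`, where `L = ∑_{i ∈ I} cᵢ xᵢ`.
Equivalently, the expectation of `Φ` at the endpoint of a lazy symmetric walk with steps `±cᵢ`. -/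
noncomputable def symExpect (p : ℝ) (c : Fin n → ℝ) (I : Finset (Fin n)) (Φ : ℝ → ℝ) : ℝ :=
  expect p fun x => expect p fun y => Φ (linForm c I x - linForm c I y)

/-- The probability that two independent bits of bias `p` differ. -/
def flipProb (p : ℝ) : ℝ := 2 * p * (1 - p)

variable {c : Fin n → ℝ} {I : Finset (Fin n)}

theorem flipProb_nonneg (hp : p ∈ Set.Icc 0 1) : 0 ≤ flipProb p :=
  mul_nonneg (mul_nonneg zero_le_two hp.1) (sub_nonneg.2 hp.2)

theorem flipProb_le_half (p : ℝ) : flipProb p ≤ 1 / 2 := by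
  unfold flipProb
  nlinarith [sq_nonneg (p - 1 / 2)]

theorem le_flipProb (hp₀ : 0 ≤ p) (hp : p ≤ 1 / 2) : p ≤ flipProb p := by
  unfold flipProb
  nlinarith

theorem linForm_update {i : Fin n} (hi : i ∉ I) (b : Bool) (x : Cube n) :
    linForm c I (Function.update x i b) = linForm c I x :=
  Finset.sum_congr rfl fun j hj => by rw [Function.update_of_ne (ne_of_mem_of_not_mem hj hi)]

theorem linForm_sub_piecewise (c : Fin n → ℝ) (I : Finset (Fin n)) (x y : Cube n) :
    linForm c .univ x - linForm c .univ (I.piecewise y x) = linForm c I x - linForm c I y := by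
  simp only [linForm, ← Finset.sum_sub_distrib]
  refine (Finset.sum_subset_zero_on_sdiff I.subset_univ (fun i hi => ?_) fun i hi => ?_).symm
  · simp [(Finset.mem_sdiff.1 hi).2]
  · simp [hi]

theorem expect_linForm_insert {i : Fin n} (hi : i ∉ I) (Ψ : ℝ → ℝ) :
    expect p (fun x => Ψ (linForm c (insert i I) x)) =
      p * expect p (fun x => Ψ (c i + linForm c I x)) +
        (1 - p) * expect p (fun x => Ψ (linForm c I x)) := by
  have split (b : Bool) (x : Cube n) : linForm c (insert i I) (Function.update x i b) =
      c i * bitVal b + linForm c I x := by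
    rw [← linForm_update hi b x, linForm, Finset.sum_insert hi, Function.update_self, linForm]
  rw [expect_eq_update i]
  simp [split, bitVal]

theorem symExpect_empty (Φ : ℝ → ℝ) : symExpect p c ∅ Φ = Φ 0 := by
  simp [symExpect, linForm, expect_const]

theorem symExpect_add (Φ Ψ : ℝ → ℝ) :
    symExpect p c I (fun t => Φ t + Ψ t) = symExpect p c I Φ + symExpect p c I Ψ := by
  simp only [symExpect, expect_add]

theorem symExpect_const_mul (a : ℝ) (Φ : ℝ → ℝ) :
    symExpect p c I (fun t => a * Φ t) = a * symExpect p c I Φ := by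
  simp only [symExpect, expect_const_mul]

theorem symExpect_const (a : ℝ) : symExpect p c I (fun _ => a) = a := by
  simp only [symExpect, expect_const]

theorem symExpect_mono (hp : p ∈ Set.Icc 0 1) {Φ Ψ : ℝ → ℝ} (h : ∀ t, Φ t ≤ Ψ t) :
    symExpect p c I Φ ≤ symExpect p c I Ψ :=
  expect_mono hp fun _ => expect_mono hp fun _ => h _

theorem symExpect_nonneg (hp : p ∈ Set.Icc 0 1) {Φ : ℝ → ℝ} (h : ∀ t, 0 ≤ Φ t) :
    0 ≤ symExpect p c I Φ :=
  expect_nonneg hp fun _ => expect_nonneg hp fun _ => h _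

theorem symExpect_insert {i : Fin n} (hi : i ∉ I) (Φ : ℝ → ℝ) :
    symExpect p c (insert i I) Φ = (1 - flipProb p) * symExpect p c I Φ +
      flipProb p / 2 *
        (symExpect p c I (fun t => Φ (t + c i)) + symExpect p c I (fun t => Φ (t - c i))) := by
  have inner (t : ℝ) : expect p (fun y => Φ (t - linForm c (insert i I) y)) =
      p * expect p (fun y => Φ (t - (c i + linForm c I y))) +
        (1 - p) * expect p (fun y => Φ (t - linForm c I y)) :=
    expect_linForm_insert hi fun u => Φ (t - u)
  simp only [symExpect, inner]
  rw [expect_linForm_insert hi fun t => p * expect p (fun y => Φ (t - (c i + linForm c I y))) +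
    (1 - p) * expect p (fun y => Φ (t - linForm c I y))]
  have add_left (u v : ℝ) : c i + u - v = u - v + c i := by ring
  simp only [expect_add, expect_const_mul, add_sub_add_left_eq_sub]
  simp only [sub_add_eq_sub_sub_swap, add_left, flipProb]
  ring

theorem symExpect_sq (p : ℝ) (c : Fin n → ℝ) (I : Finset (Fin n)) :
    symExpect p c I (fun t => t ^ 2) = flipProb p * ∑ i ∈ I, c i ^ 2 := by
  induction I using Finset.induction_on with
  | empty => simp [symExpect_empty]
  | insert i I hi ih =>
    have parallelogram :
        (fun t : ℝ => (t + c i) ^ 2 + (t - c i) ^ 2) = fun t => 2 * t ^ 2 + 2 * c i ^ 2 := by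
      funext t; ring
    rw [symExpect_insert hi, ← symExpect_add, parallelogram, symExpect_add, symExpect_const_mul,
      symExpect_const, ih, Finset.sum_insert hi]
    ring

theorem symExpect_sq_insert {i : Fin n} (hi : i ∉ I) :
    symExpect p c (insert i I) (fun t => t ^ 2) =
      symExpect p c I (fun t => t ^ 2) + flipProb p * c i ^ 2 := by
  rw [symExpect_sq, symExpect_sq, Finset.sum_insert hi]
  ring

theorem symExpect_pow_four_le (hp : p ∈ Set.Icc 0 1) {b : ℝ} (hc : ∀ i ∈ I, c i ^ 2 ≤ b) :
    symExpect p c I (fun t => t ^ 4) ≤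
      3 * symExpect p c I (fun t => t ^ 2) ^ 2 + b * symExpect p c I (fun t => t ^ 2) := by
  induction I using Finset.induction_on with
  | empty => simp [symExpect_empty]
  | insert i I hi ih =>
    have ih := ih fun j hj => hc j (Finset.mem_insert_of_mem hj)
    have expansion : (fun t : ℝ => (t + c i) ^ 4 + (t - c i) ^ 4) =
        fun t => (2 * t ^ 4 + 12 * c i ^ 2 * t ^ 2) + 2 * c i ^ 4 := by
      funext t; ring
    rw [symExpect_sq_insert hi, symExpect_insert hi, ← symExpect_add, expansion, symExpect_add,
      symExpect_add, symExpect_const_mul, symExpect_const_mul, symExpect_const]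
    have hci : flipProb p * c i ^ 2 * c i ^ 2 ≤ flipProb p * c i ^ 2 * b :=
      mul_le_mul_of_nonneg_left (hc i (Finset.mem_insert_self i I))
        (mul_nonneg (flipProb_nonneg hp) (sq_nonneg _))
    linarith [sq_nonneg (flipProb p * c i ^ 2)]

/-- The contribution of the pairs `x, y` which differ in at most one coordinate of `I`. -/
theorem one_sub_flipProb_pow_mul_le_symExpect (hp : p ∈ Set.Icc 0 1) (c : Fin n → ℝ)
    (I : Finset (Fin n)) {Φ : ℝ → ℝ} (hΦ : ∀ t, 0 ≤ Φ t) :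
    (1 - flipProb p) ^ I.card * (Φ 0 + flipProb p / 2 * ∑ i ∈ I, (Φ (c i) + Φ (-c i))) ≤
      symExpect p c I Φ := by
  have hq₀ := flipProb_nonneg hp
  have hq₁ := flipProb_le_half p
  induction I using Finset.induction_on generalizing Φ with
  | empty => simp [symExpect_empty]
  | insert i I hi ih =>
    rw [symExpect_insert hi, Finset.card_insert_of_notMem hi, Finset.sum_insert hi]
    set q := flipProb p
    have stay : (1 - q) * ((1 - q) ^ I.card * (Φ 0 + q / 2 * ∑ j ∈ I, (Φ (c j) + Φ (-c j)))) ≤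
        (1 - q) * symExpect p c I Φ :=
      mul_le_mul_of_nonneg_left (ih hΦ) (by linarith)
    have step (a : ℝ) :
        (1 - q) ^ (I.card + 1) * Φ a ≤ symExpect p c I (fun t => Φ (t + a)) :=
      calc (1 - q) ^ (I.card + 1) * Φ a
          ≤ (1 - q) ^ I.card * (Φ (0 + a) +
              q / 2 * ∑ j ∈ I, (Φ (c j + a) + Φ (-c j + a))) := by
            rw [zero_add]
            refine mul_le_mul (pow_le_pow_of_le_one (by linarith) (by linarith) (Nat.le_succ _))
              (le_add_of_nonneg_right (mul_nonneg (by linarith) (Finset.sum_nonneg fun j _ =>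
                add_nonneg (hΦ _) (hΦ _)))) (hΦ a) (pow_nonneg (by linarith) _)
        _ ≤ symExpect p c I (fun t => Φ (t + a)) := ih fun t => hΦ (t + a)
    have move := mul_le_mul_of_nonneg_left (add_le_add (step (c i)) (step (-c i)))
      (div_nonneg hq₀ zero_le_two)
    simp only [← sub_eq_add_neg] at move
    rw [pow_succ] at move ⊢
    linarith

/-! ### The squared distance to `{-1, 0, 1}` -/

/-- The squared distance from `t` to `{-1, 0, 1}`, the set of differences of two bits. -/
noncomputable def sqDist (t : ℝ) : ℝ := min (t ^ 2) ((|t| - 1) ^ 2)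

/-- A point of `{-1, 0, 1}` nearest to `t`; it is `0` in the tie cases `t = ±1/2`. -/
noncomputable def nearestUnit (t : ℝ) : ℝ := if |t| ≤ 1 / 2 then 0 else if 0 < t then 1 else -1

theorem sqDist_nonneg (t : ℝ) : 0 ≤ sqDist t := le_min (sq_nonneg _) (sq_nonneg _)

theorem sqDist_zero : sqDist 0 = 0 := by simp [sqDist]

theorem sqDist_neg (t : ℝ) : sqDist (-t) = sqDist t := by simp [sqDist]

theorem sqDist_of_abs_le_half {t : ℝ} (h : |t| ≤ 1 / 2) : sqDist t = t ^ 2 := by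
  refine min_eq_left ?_
  rw [← sq_abs t]
  nlinarith

theorem sqDist_of_half_le_abs {t : ℝ} (h : 1 / 2 ≤ |t|) : sqDist t = (|t| - 1) ^ 2 := by
  refine min_eq_right ?_
  rw [← sq_abs t]
  nlinarith

theorem nearestUnit_of_abs_le_half {t : ℝ} (h : |t| ≤ 1 / 2) : nearestUnit t = 0 := if_pos h

theorem nearestUnit_of_half_lt_abs {t : ℝ} (h : 1 / 2 < |t|) :
    nearestUnit t = 1 ∨ nearestUnit t = -1 := by
  rw [nearestUnit, if_neg (not_le.2 h)]
  exact ite_eq_or_eq _ _ _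

theorem sub_nearestUnit_sq (t : ℝ) : (t - nearestUnit t) ^ 2 = sqDist t := by
  rcases le_or_gt |t| (1 / 2) with h | h
  · rw [nearestUnit_of_abs_le_half h, sqDist_of_abs_le_half h, sub_zero]
  · rw [nearestUnit, if_neg (not_le.2 h), sqDist_of_half_le_abs h.le]
    split_ifs with ht
    · rw [abs_of_pos ht]
    · rw [abs_of_nonpos (not_lt.1 ht)]
      ring

theorem sqDist_le_sub_bitVal_sq (t : ℝ) (a b : Bool) :
    sqDist t ≤ (t - (bitVal a - bitVal b)) ^ 2 := by
  cases a <;> cases b <;> simp only [bitVal, if_true, Bool.false_eq_true, if_false]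
  · exact (min_le_left _ _).trans_eq (by ring)
  · exact (min_le_right _ _).trans (by nlinarith [neg_abs_le t, sq_abs t])
  · exact (min_le_right _ _).trans (by nlinarith [le_abs_self t, sq_abs t])
  · exact (min_le_left _ _).trans_eq (by ring)

theorem sqDist_sub_le (u v : ℝ) (a b : Bool) :
    sqDist (u - v) ≤ 2 * (bitVal a - u) ^ 2 + 2 * (bitVal b - v) ^ 2 :=
  (sqDist_le_sub_bitVal_sq (u - v) a b).trans
    (by nlinarith [sq_nonneg ((bitVal a - u) + (bitVal b - v))])

theorem sq_sub_pow_four_le_sqDist (t : ℝ) : (3 / 4 * t ^ 2 - t ^ 4) / 16 ≤ sqDist t := by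
  refine le_min ?_ ?_
  · nlinarith [sq_nonneg t, sq_nonneg (t ^ 2)]
  · have h4 : t ^ 4 = |t| ^ 4 := (Even.pow_abs (by decide) t).symm
    rw [h4, ← sq_abs t]
    nlinarith [sq_nonneg (|t| ^ 2 - 3 / 4), sq_nonneg (|t| - 64 / 67)]

/-- One of `a + b` and `a - b` has absolute value `|a| + |b| ≥ |a| + 1/2`, so it is far from
`{-1, 0, 1}` unless `|a|` is far from `1`. -/
theorem eighth_le_sqDist_add {a b : ℝ} (ha : 1 / 2 ≤ |a|) (hb : 1 / 2 ≤ |b|) :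
    1 / 8 ≤ sqDist a + (sqDist (a + b) + sqDist (a - b)) := by
  have far {t : ℝ} (ht : |t| = |a| + |b|) : (|a| - 1 / 2) ^ 2 ≤ sqDist t := by
    rw [sqDist_of_half_le_abs (by linarith), ht]
    exact pow_le_pow_left₀ (by linarith) (by linarith) 2
  have sum_or_difference : (|a| - 1 / 2) ^ 2 ≤ sqDist (a + b) + sqDist (a - b) := by
    have h : |a + b| = |a| + |b| ∨ |a - b| = |a| + |b| := by grind
    rcases h with h | h
    · exact (far h).trans (le_add_of_nonneg_right (sqDist_nonneg _))
    · exact (far h).trans (le_add_of_nonneg_left (sqDist_nonneg _))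
  rw [sqDist_of_half_le_abs ha]
  nlinarith [sq_nonneg (|a| - 3 / 4)]

/-! ### The coefficients of the affine approximation -/

theorem symExpect_sqDist_le (hp : p ∈ Set.Icc 0 1) {ε c₀ : ℝ} {f : Cube n → Bool}
    (hf : IsClose p ε (boolFun f) fun x => c₀ + linForm c .univ x) (I : Finset (Fin n)) :
    symExpect p c I sqDist ≤ 4 * ε := by
  set e : Cube n → ℝ := fun x => (bitVal (f x) - (c₀ + linForm c .univ x)) ^ 2
  calc symExpect p c I sqDist
      ≤ expect p fun x => expect p fun y => 2 * e x + 2 * e (I.piecewise y x) :=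
        expect_mono hp fun x => expect_mono hp fun y => by
          rw [← linForm_sub_piecewise, ← add_sub_add_left_eq_sub _ _ c₀]
          exact sqDist_sub_le _ _ _ _
    _ = 4 * expect p e := by
        simp only [expect_add, expect_const_mul, expect_const, expect_expect_piecewise I e]
        ring
    _ ≤ 4 * ε := mul_le_mul_of_nonneg_left hf (by norm_num)

/-- Adding the coefficients one at a time keeps the second moment `v` small, since the inequality
`v ≤ 32 δ + 6 v ^ 2` excludes the values of `v` between the two roots of the quadratic. -/
theorem symExpect_sq_le_of_abs_le_half (hp : p ∈ Set.Icc 0 1) {δ : ℝ} (hδ : δ ≤ 1 / 1024)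
    (hI : ∀ J, symExpect p c J sqDist ≤ δ) (hc : ∀ i ∈ I, |c i| ≤ 1 / 2) :
    symExpect p c I (fun t => t ^ 2) ≤ 64 * δ := by
  have hδ₀ : 0 ≤ δ := (symExpect_nonneg hp sqDist_nonneg).trans (hI ∅)
  have hc_sq (i : Fin n) (hi : i ∈ I) : c i ^ 2 ≤ 1 / 4 := by
    rw [← sq_abs]
    nlinarith [hc i hi, abs_nonneg (c i)]
  induction I using Finset.induction_on with
  | empty => simp [symExpect_empty, hδ₀]
  | insert i I hi ih =>
    have ih := ih (fun j hj => hc j (Finset.mem_insert_of_mem hj))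
      fun j hj => hc_sq j (Finset.mem_insert_of_mem hj)
    have single : flipProb p * c i ^ 2 ≤ δ := by
      have h := hI (insert i ∅)
      rw [symExpect_insert (Finset.notMem_empty i)] at h
      simp only [symExpect_empty, zero_add, zero_sub, sqDist_neg, sqDist_zero,
        sqDist_of_abs_le_half (hc i (Finset.mem_insert_self i I))] at h
      linarith
    have fourth := symExpect_pow_four_le hp hc_sq
    have quartic : 1 / 16 * (3 / 4 * symExpect p c (insert i I) (fun t => t ^ 2) +
        -1 * symExpect p c (insert i I) (fun t => t ^ 4)) ≤ δ := by
      rw [← symExpect_const_mul, ← symExpect_const_mul, ← symExpect_add, ← symExpect_const_mul]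
      refine (symExpect_mono hp fun t => ?_).trans (hI (insert i I))
      linarith [sq_sub_pow_four_le_sqDist t]
    have grow := symExpect_sq_insert (p := p) (c := c) hi
    have nonneg : 0 ≤ symExpect p c (insert i I) (fun t => t ^ 2) :=
      symExpect_nonneg hp sq_nonneg
    set v := symExpect p c (insert i I) (fun t => t ^ 2)
    have a_priori : v ≤ 65 * δ := by linarith
    nlinarith [mul_le_mul_of_nonneg_left a_priori nonneg]

theorem quarter_le_one_sub_pow {q : ℝ} {k : ℕ} (hq₀ : 0 ≤ q) (hq : q ≤ 1 / 2) (hk : k * q ≤ 1) :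
    1 / 4 ≤ (1 - q) ^ k :=
  calc (1 / 4 : ℝ) = (1 / 2 : ℝ) ^ (2 : ℝ) := by norm_num
    _ ≤ (1 / 2 : ℝ) ^ (2 * q * k) :=
      Real.rpow_le_rpow_of_exponent_ge (by norm_num) (by norm_num) (by linarith)
    _ = ((1 / 2 : ℝ) ^ (2 * q)) ^ k := Real.rpow_mul_natCast (by norm_num) _ _
    _ ≤ (1 - q) ^ k := by
      refine pow_le_pow_left₀ (by positivity) ?_ k
      have bernoulli := rpow_one_add_le_one_add_mul_self (s := -(1 / 2)) (by norm_num)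
        (mul_nonneg zero_le_two hq₀) (by linarith : 2 * q ≤ 1)
      norm_num at bernoulli ⊢
      linarith

theorem flipProb_mul_sum_sqDist_le (hp : p ∈ Set.Icc 0 1) {δ : ℝ}
    (hI : symExpect p c I sqDist ≤ δ) (hcard : I.card * flipProb p ≤ 1) :
    flipProb p * ∑ i ∈ I, sqDist (c i) ≤ 4 * δ := by
  have h := (one_sub_flipProb_pow_mul_le_symExpect hp c I sqDist_nonneg).trans hI
  have sum_nonneg : 0 ≤ flipProb p * ∑ i ∈ I, sqDist (c i) :=
    mul_nonneg (flipProb_nonneg hp) (Finset.sum_nonneg fun i _ => sqDist_nonneg _)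
  simp only [sqDist_zero, sqDist_neg, ← two_mul, ← Finset.mul_sum] at h
  have := mul_le_mul_of_nonneg_right
    (quarter_le_one_sub_pow (flipProb_nonneg hp) (flipProb_le_half p) hcard) sum_nonneg
  linarith

theorem card_mul_le_symExpect_sqDist_add_sub (hp : p ∈ Set.Icc 0 1) (hc : ∀ i ∈ I, 1 / 2 ≤ |c i|)
    (hcard : I.card * flipProb p ≤ 1) {a : ℝ} (ha : 1 / 2 ≤ |a|) :
    (1 - flipProb p) ^ I.card * (I.card * flipProb p / 8) ≤
      symExpect p c I (fun t => sqDist (t + a) + sqDist (t - a)) := by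
  have hq₀ := flipProb_nonneg hp
  refine le_trans (mul_le_mul_of_nonneg_left ?_ (pow_nonneg (by linarith [flipProb_le_half p]) _))
    (one_sub_flipProb_pow_mul_le_symExpect hp c I fun t =>
      add_nonneg (sqDist_nonneg _) (sqDist_nonneg _))
  have reflect (i : Fin n) :
      sqDist (c i + a) + sqDist (c i - a) + (sqDist (-c i + a) + sqDist (-c i - a)) =
        2 * (sqDist (a + c i) + sqDist (a - c i)) := by
    rw [← sqDist_neg (-c i - a), ← sqDist_neg (c i - a)]
    ring_nf
  have pairs := Finset.card_nsmul_le_sum I _ (1 / 8) fun i hi => eighth_le_sqDist_add ha (hc i hi)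
  rw [Finset.sum_add_distrib, Finset.sum_const, nsmul_eq_mul, nsmul_eq_mul] at pairs
  simp only [reflect, ← Finset.mul_sum, zero_add, zero_sub, sqDist_neg]
  linarith [mul_le_mul_of_nonneg_left pairs hq₀, sqDist_nonneg a,
    mul_le_mul_of_nonneg_right hcard (sqDist_nonneg a)]

/-- The contribution of the pairs `x, y` which differ in exactly two coordinates of `I`. -/
theorem card_mul_card_sub_one_le_symExpect (hp : p ∈ Set.Icc 0 1) (hc : ∀ i ∈ I, 1 / 2 ≤ |c i|)
    (hcard : I.card * flipProb p ≤ 1) :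
    (1 - flipProb p) ^ I.card * (flipProb p ^ 2 / 32 * (I.card * (I.card - 1))) ≤
      symExpect p c I sqDist := by
  have hq₀ := flipProb_nonneg hp
  have hq₁ := flipProb_le_half p
  induction I using Finset.induction_on with
  | empty => simpa [symExpect_empty] using sqDist_nonneg 0
  | insert i I hi ih =>
    rw [Finset.card_insert_of_notMem hi, Nat.cast_succ] at hcard ⊢
    have hcI (j : Fin n) (hj : j ∈ I) : 1 / 2 ≤ |c j| := hc j (Finset.mem_insert_of_mem hj)
    have hcardI : I.card * flipProb p ≤ 1 := by linarith
    have stay := mul_le_mul_of_nonneg_left (ih hcI hcardI) (by linarith : 0 ≤ 1 - flipProb p)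
    have move := mul_le_mul_of_nonneg_left
      (card_mul_le_symExpect_sqDist_add_sub hp hcI hcardI (hc i (Finset.mem_insert_self i I)))
      (div_nonneg hq₀ zero_le_two)
    have shrink : (1 - flipProb p) ^ (I.card + 1) * (flipProb p ^ 2 * I.card) ≤
        (1 - flipProb p) ^ I.card * (flipProb p ^ 2 * I.card) :=
      mul_le_mul_of_nonneg_right (pow_le_pow_of_le_one (by linarith) (by linarith) (Nat.le_succ _))
        (by positivity)
    rw [symExpect_insert hi, ← symExpect_add]
    rw [pow_succ] at shrink ⊢
    linarith

theorem card_mul_card_sub_one_mul_sq_le (hp : p ∈ Set.Icc 0 1) {δ : ℝ}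
    (hI : symExpect p c I sqDist ≤ δ) (hc : ∀ i ∈ I, 1 / 2 ≤ |c i|)
    (hcard : I.card * flipProb p ≤ 1) :
    I.card * (I.card - 1) * flipProb p ^ 2 ≤ 128 * δ := by
  have pairs_nonneg : (0 : ℝ) ≤ I.card * (I.card - 1) := by
    linarith [Nat.cast_choose_two ℝ I.card, Nat.cast_nonneg (α := ℝ) (I.card.choose 2)]
  have := mul_le_mul_of_nonneg_right
    (quarter_le_one_sub_pow (flipProb_nonneg hp) (flipProb_le_half p) hcard)
    (mul_nonneg pairs_nonneg (sq_nonneg (flipProb p)))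
  linarith [(card_mul_card_sub_one_le_symExpect hp hc hcard).trans hI]

/-- Adding the indices one at a time keeps `I.card * flipProb p` below `1`, as the bound on the
number of pairs improves `I.card * flipProb p ≤ 1` to `I.card * flipProb p ≤ 1 / 2`. -/
theorem card_mul_flipProb_le_half (hp : p ∈ Set.Icc 0 1) {δ : ℝ} (hδ : δ ≤ 1 / 1024)
    (hI : ∀ J, symExpect p c J sqDist ≤ δ) (hc : ∀ i ∈ I, 1 / 2 ≤ |c i|) :
    I.card * flipProb p ≤ 1 / 2 := by
  have hq₁ := flipProb_le_half p
  induction I using Finset.induction_on with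
  | empty => simp
  | insert i I hi ih =>
    have ih := ih fun j hj => hc j (Finset.mem_insert_of_mem hj)
    have card_insert : ((insert i I).card : ℝ) = I.card + 1 := by
      rw [Finset.card_insert_of_notMem hi, Nat.cast_succ]
    have pairs := card_mul_card_sub_one_mul_sq_le hp (hI (insert i I)) hc
      (by rw [card_insert]; linarith)
    rw [card_insert] at pairs ⊢
    rcases I.eq_empty_or_nonempty with rfl | hne
    · simpa using hq₁
    · have one_le : (1 : ℝ) ≤ I.card := by exact_mod_cast hne.card_pos
      refine abs_le_of_sq_le_sq' ?_ (by norm_num) |>.2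
      nlinarith [mul_le_mul_of_nonneg_left one_le
        (mul_nonneg (by linarith : (0 : ℝ) ≤ I.card + 1) (sq_nonneg (flipProb p)))]

theorem flipProb_mul_sum_univ_sqDist_le (hp : p ∈ Set.Icc 0 1) {δ : ℝ} (hδ : δ ≤ 1 / 1024)
    (hI : ∀ J, symExpect p c J sqDist ≤ δ) : flipProb p * ∑ i, sqDist (c i) ≤ 68 * δ := by
  have small := symExpect_sq_le_of_abs_le_half hp hδ hI
    (I := {i | ¬1 / 2 < |c i|}) (by simp)
  have large_half_le (i : Fin n) (hi : i ∈ Finset.univ.filter fun i => 1 / 2 < |c i|) :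
      1 / 2 ≤ |c i| := (Finset.mem_filter.1 hi).2.le
  have large := flipProb_mul_sum_sqDist_le hp (hI _)
    ((card_mul_flipProb_le_half hp hδ hI large_half_le).trans (by norm_num))
  rw [symExpect_sq, ← Finset.sum_congr rfl fun i hi =>
    sqDist_of_abs_le_half (not_lt.1 (Finset.mem_filter.1 hi).2)] at small
  rw [← Finset.sum_filter_add_sum_filter_not _ fun i => 1 / 2 < |c i|, mul_add]
  linarith

/-! ### Approximation by a linear form with coefficients `±1` -/

theorem exists_linForm_isClose_const (hp : p ∈ Set.Icc 0 1) (c : Fin n → ℝ) :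
    ∃ a, IsClose p (flipProb p * ∑ i, c i ^ 2) (linForm c .univ) fun _ => a := by
  obtain ⟨y, hy⟩ := exists_le_expect hp fun y : Cube n =>
    expect p fun x => (linForm c .univ y - linForm c .univ x) ^ 2
  refine ⟨linForm c .univ y, Eq.trans_le ?_ (hy.trans_eq (symExpect_sq p c .univ))⟩
  exact congrArg (expect p) (funext fun x => sub_sq_comm _ _)

theorem linForm_sub_of_support (c : Fin n → ℝ) {s : Fin n → ℝ} (hs : ∀ i ∉ I, s i = 0)
    (x : Cube n) :
    linForm (fun i => c i - s i) .univ x = linForm c .univ x - linForm s I x := by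
  have supported : linForm s I x = linForm s .univ x :=
    Finset.sum_subset I.subset_univ fun i _ hi => by rw [hs i hi, zero_mul]
  rw [supported]
  simp only [linForm, sub_mul, Finset.sum_sub_distrib]

theorem exists_isClose_signed_linForm (hp : p ∈ Set.Icc 0 1) {ε : ℝ} (hε : ε ≤ 1 / 4096)
    {f : Cube n → Bool} {l : Cube n → ℝ} (hl : IsAffine l) (hf : IsClose p ε (boolFun f) l) :
    ∃ (a : ℝ) (s : Fin n → ℝ) (G : Finset (Fin n)), (∀ i ∈ G, s i = 1 ∨ s i = -1) ∧
      G.card * flipProb p ≤ 1 / 2 ∧ G.card * (G.card - 1) * flipProb p ^ 2 ≤ 512 * ε ∧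
      IsClose p (546 * ε) (boolFun f) fun x => a + linForm s G x := by
  obtain ⟨c₀, c, hc⟩ := hl
  obtain rfl : l = fun x => c₀ + linForm c .univ x := funext hc
  have hI := symExpect_sqDist_le hp hf
  have hδ : 4 * ε ≤ 1 / 1024 := by linarith
  let s i := nearestUnit (c i)
  let G : Finset (Fin n) := {i | 1 / 2 < |c i|}
  have large (i : Fin n) (hi : i ∈ G) : 1 / 2 < |c i| := (Finset.mem_filter.1 hi).2
  have card_le := card_mul_flipProb_le_half hp hδ hI fun i hi => (large i hi).le
  have pairs_le := card_mul_card_sub_one_mul_sq_le hp (hI G) (fun i hi => (large i hi).le)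
    (card_le.trans (by norm_num))
  obtain ⟨a, ha⟩ := exists_linForm_isClose_const hp fun i => c i - s i
  have residual := linForm_sub_of_support c (s := s) (I := G) fun i hi =>
    nearestUnit_of_abs_le_half (by simpa [G] using hi)
  have close : IsClose p (272 * ε) (fun x => c₀ + linForm c .univ x)
      fun x => c₀ + a + linForm s G x :=
    calc expect p (fun x => (c₀ + linForm c .univ x - (c₀ + a + linForm s G x)) ^ 2)
        = expect p (fun x => (linForm (fun i => c i - s i) .univ x - a) ^ 2) := by
          simp only [residual]
          congr! 3
          ring
      _ ≤ flipProb p * ∑ i, sqDist (c i) := by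
          simp only [s, sub_nearestUnit_sq] at ha
          exact ha
      _ ≤ 272 * ε := by linarith [flipProb_mul_sum_univ_sqDist_le hp hδ hI]
  refine ⟨c₀ + a, s, G, fun i hi => nearestUnit_of_half_lt_abs (large i hi), card_le,
    by linarith, ?_⟩
  convert hf.trans hp close using 1
  ring

/-! ### Rounding to a maximum -/

theorem maxVars_eq_one {S : Finset (Fin n)} {x : Cube n} {i : Fin n} (hi : i ∈ S)
    (hx : x i = true) : maxVars S x = 1 := by
  have : S.sup x = true := top_unique (hx.ge.trans (Finset.le_sup hi))
  simp [maxVars, boolFun, bitVal, this]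

theorem maxVars_eq_zero {S : Finset (Fin n)} {x : Cube n} (hx : ∀ i ∈ S, x i = false) :
    maxVars S x = 0 := by
  have : S.sup x = false := (Finset.sup_eq_bot_iff _ _).2 hx
  simp [maxVars, boolFun, bitVal, this]

theorem linForm_eq_zero {x : Cube n} (hx : ∀ i ∈ I, x i = false) : linForm c I x = 0 :=
  Finset.sum_eq_zero fun i hi => by simp [hx i hi, bitVal]

theorem linForm_eq_of_unique {x : Cube n} {i : Fin n} (hi : i ∈ I) (hxi : x i = true)
    (hx : ∀ j ∈ I, j ≠ i → x j = false) : linForm c I x = c i :=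
  (Finset.sum_eq_single_of_mem i hi fun j hj hji => by simp [hx j hj hji, bitVal]).trans
    (by simp [hxi, bitVal])

/-- The number of ordered pairs of distinct elements of `I` at which `x` is one. -/
noncomputable def pairCount (I : Finset (Fin n)) (x : Cube n) : ℝ :=
  ∑ z ∈ I.offDiag, bitVal (x z.1) * bitVal (x z.2)

theorem pairCount_nonneg (I : Finset (Fin n)) (x : Cube n) : 0 ≤ pairCount I x :=
  Finset.sum_nonneg fun _ _ => mul_nonneg (bitVal_nonneg _) (bitVal_nonneg _)

theorem one_le_pairCount {x : Cube n} {i j : Fin n} (hi : i ∈ I) (hj : j ∈ I) (hij : i ≠ j)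
    (hxi : x i = true) (hxj : x j = true) : 1 ≤ pairCount I x :=
  calc (1 : ℝ) = bitVal (x i) * bitVal (x j) := by simp [hxi, hxj, bitVal]
    _ ≤ pairCount I x :=
      Finset.single_le_sum (f := fun z => bitVal (x z.1) * bitVal (x z.2))
        (fun z _ => mul_nonneg (bitVal_nonneg _) (bitVal_nonneg _))
        (Finset.mem_offDiag.2 ⟨hi, hj, hij⟩ : (i, j) ∈ I.offDiag)

theorem expect_pairCount (I : Finset (Fin n)) :
    expect p (pairCount I) = I.card * (I.card - 1) * p ^ 2 := by
  calc expect p (pairCount I) = ∑ z ∈ I.offDiag, p ^ 2 := by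
        refine (expect_sum _ _).trans (Finset.sum_congr rfl fun z hz => ?_)
        exact expect_bitVal_mul_bitVal (Finset.mem_offDiag.1 hz).2.2
    _ = I.card * (I.card - 1) * p ^ 2 := by
        rw [Finset.sum_const, Finset.offDiag_card, nsmul_eq_mul,
          Nat.cast_sub (Nat.le_mul_self _), Nat.cast_mul]
        ring

theorem bitVal_sq_le (b : Bool) {t : ℝ} (ht : t ≤ 1 / 4) :
    bitVal b ^ 2 ≤ 2 * (bitVal b - t) ^ 2 := by
  cases b <;> simp only [bitVal, if_true, Bool.false_eq_true, if_false] <;> nlinarith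

theorem bitVal_sub_one_sq_le (b : Bool) {t : ℝ} (ht : 3 / 4 ≤ t) :
    (bitVal b - 1) ^ 2 ≤ 2 * (bitVal b - t) ^ 2 := by
  cases b <;> simp only [bitVal, if_true, Bool.false_eq_true, if_false] <;> nlinarith

theorem bitVal_sub_maxVars_sq_le {a : ℝ} (ha : |a| ≤ 1 / 4) {s : Fin n → ℝ}
    (hs : ∀ i ∈ I, s i = 1 ∨ s i = -1) (b : Bool) (x : Cube n) :
    (bitVal b - maxVars {i ∈ I | s i = 1} x) ^ 2 ≤
      pairCount I x + 2 * (bitVal b - (a + linForm s I x)) ^ 2 := by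
  obtain ⟨ha_ge, ha_le⟩ := abs_le.1 ha
  have of_rounding {m : ℝ} (h : (bitVal b - m) ^ 2 ≤ 2 * (bitVal b - (a + linForm s I x)) ^ 2) :=
    h.trans (le_add_of_nonneg_left (pairCount_nonneg I x))
  by_cases hzero : ∀ i ∈ I, x i = false
  · refine of_rounding ?_
    rw [maxVars_eq_zero fun i hi => hzero i (Finset.mem_filter.1 hi).1, linForm_eq_zero hzero,
      sub_zero, add_zero]
    exact bitVal_sq_le b ha_le
  simp only [not_forall, Bool.not_eq_false] at hzero
  obtain ⟨i, hi, hxi⟩ := hzero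
  by_cases hunique : ∀ j ∈ I, j ≠ i → x j = false
  · refine of_rounding ?_
    rw [linForm_eq_of_unique hi hxi hunique]
    rcases hs i hi with hsi | hsi
    · rw [maxVars_eq_one (Finset.mem_filter.2 ⟨hi, hsi⟩) hxi, hsi]
      exact bitVal_sub_one_sq_le b (by linarith)
    · have outside (j : Fin n) (hj : j ∈ I.filter fun i => s i = 1) : x j = false := by
        obtain ⟨hjI, hsj⟩ := Finset.mem_filter.1 hj
        refine hunique j hjI ?_
        rintro rfl
        norm_num [hsj] at hsi
      rw [maxVars_eq_zero outside, hsi, sub_zero]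
      exact bitVal_sq_le b (by linarith)
  · simp only [not_forall, Bool.not_eq_false] at hunique
    obtain ⟨j, hj, hji, hxj⟩ := hunique
    have at_most_one : (bitVal b - maxVars {i ∈ I | s i = 1} x) ^ 2 ≤ 1 := by
      cases b <;> cases h : (I.filter fun i => s i = 1).sup x <;>
        simp [maxVars, boolFun, bitVal, h]
    linarith [one_le_pairCount hj hi hji hxj hxi,
      sq_nonneg (bitVal b - (a + linForm s I x))]

theorem IsClose.maxVars_filter (hp : p ∈ Set.Icc 0 1) {η a : ℝ} (ha : |a| ≤ 1 / 4)
    {s : Fin n → ℝ} (hs : ∀ i ∈ I, s i = 1 ∨ s i = -1) {f : Cube n → Bool}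
    (hf : IsClose p η (boolFun f) fun x => a + linForm s I x) :
    IsClose p (I.card * (I.card - 1) * p ^ 2 + 2 * η) (boolFun f) (maxVars {i ∈ I | s i = 1}) :=
  calc expect p (fun x => (bitVal (f x) - maxVars {i ∈ I | s i = 1} x) ^ 2)
      ≤ expect p (fun x => pairCount I x + 2 * (bitVal (f x) - (a + linForm s I x)) ^ 2) :=
        expect_mono hp fun x => bitVal_sub_maxVars_sq_le ha hs (f x) x
    _ ≤ I.card * (I.card - 1) * p ^ 2 + 2 * η := by
        rw [expect_add, expect_pairCount, expect_const_mul]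
        exact add_le_add_right (mul_le_mul_of_nonneg_left hf zero_le_two) _

/-- With probability at least `1 / 2` all `x i` with `i ∈ I` vanish, and then the approximation is
the constant `a`. -/
theorem min_sq_le_of_isClose (hp : p ∈ Set.Icc 0 1) {η a : ℝ} (hcard : I.card * p ≤ 1 / 2)
    {f : Cube n → Bool} (hf : IsClose p η (boolFun f) fun x => a + linForm c I x) :
    min (a ^ 2) ((1 - a) ^ 2) ≤ 2 * η := by
  set m := min (a ^ 2) ((1 - a) ^ 2)
  have m_nonneg : 0 ≤ m := le_min (sq_nonneg _) (sq_nonneg _)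
  have pointwise (x : Cube n) : m + -m * ∑ i ∈ I, bitVal (x i) ≤
      (bitVal (f x) - (a + linForm c I x)) ^ 2 := by
    by_cases hzero : ∀ i ∈ I, x i = false
    · rw [linForm_eq_zero hzero, Finset.sum_eq_zero fun i hi => by simp [hzero i hi, bitVal]]
      cases f x
      · exact (add_le_of_nonpos_right (by simp)).trans ((min_le_left _ _).trans_eq
          (by simp [bitVal]))
      · exact (add_le_of_nonpos_right (by simp)).trans ((min_le_right _ _).trans_eq
          (by simp [bitVal]))
    · simp only [not_forall, Bool.not_eq_false] at hzero
      obtain ⟨i, hi, hxi⟩ := hzero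
      have one_le : 1 ≤ ∑ i ∈ I, bitVal (x i) := by
        simpa [hxi, bitVal] using
          Finset.single_le_sum (f := fun i => bitVal (x i)) (fun i _ => bitVal_nonneg _) hi
      nlinarith [sq_nonneg (bitVal (f x) - (a + linForm c I x))]
  have mean := (expect_mono hp pointwise).trans hf
  simp only [expect_add, expect_const, expect_const_mul, expect_sum, expect_bitVal,
    Finset.sum_const, nsmul_eq_mul] at mean
  nlinarith

theorem IsClose.one_sub {ε : ℝ} {g h : Cube n → ℝ} (hgh : IsClose p ε g h) :
    IsClose p ε (1 - g) (1 - h) := by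
  simpa only [IsClose, normSq, Pi.sub_apply, sub_sub_sub_cancel_left, sub_sq_comm] using hgh

theorem IsClose.not_linForm {η a : ℝ} {f : Cube n → Bool}
    (hf : IsClose p η (boolFun f) fun x => a + linForm c I x) :
    IsClose p η (boolFun fun x => !f x) fun x => (1 - a) + linForm (-c) I x := by
  rw [← one_sub_boolFun]
  convert hf.one_sub using 2 with x
  simp only [linForm, Pi.neg_apply, neg_mul, Finset.sum_neg_distrib, Pi.one_apply, Pi.sub_apply]
  ring

theorem natCast_le_max_of_mul_sub_one_le {k : ℕ} {r : ℝ} (hp : 0 < p)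
    (hk : k * (k - 1) * p ^ 2 ≤ 512 * r) : k ≤ max 1 (32 * (√r / p)) := by
  rcases le_or_gt k 1 with h | h
  · exact le_max_of_le_left (by exact_mod_cast h)
  · have two_le : (2 : ℝ) ≤ k := by exact_mod_cast h
    have sq_le : (k * p / 32) ^ 2 ≤ r := by nlinarith [mul_pos (by linarith : (0 : ℝ) < k) hp]
    refine le_max_of_le_right ?_
    rw [mul_div_assoc', le_div_iff₀ hp]
    linarith [Real.le_sqrt_of_sq_le sq_le]

/-- If the constant term of the linear approximation to `f` is close to `1` rather than to `0`, then
the linear approximation to `1 - f` has its constant term close to `0`, and the signs change. -/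
theorem exists_isClose_maxVars_of_le (hp₀ : 0 < p) (hp : p ≤ 1 / 2) {ε : ℝ}
    (hε : ε ≤ 1 / 20000) {f : Cube n → Bool} {l : Cube n → ℝ} (hl : IsAffine l)
    (hf : IsClose p ε (boolFun f) l) :
    ∃ S : Finset (Fin n), S.card ≤ max 1 (32 * (√ε / p)) ∧
      (IsClose p (1604 * ε) (boolFun f) (maxVars S) ∨
        IsClose p (1604 * ε) (1 - boolFun f) (maxVars S)) := by
  have hp₁ : p ∈ Set.Icc 0 1 := ⟨hp₀.le, hp.trans (by norm_num)⟩
  have p_le := le_flipProb hp₀.le hp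
  obtain ⟨a, s, G, hs, card_le, pairs_le, close⟩ :=
    exists_isClose_signed_linForm hp₁ (by linarith) hl hf
  have card_mul_le : G.card * p ≤ 1 / 2 :=
    (mul_le_mul_of_nonneg_left p_le (Nat.cast_nonneg _)).trans card_le
  have pairs_mul_le : G.card * (G.card - 1) * p ^ 2 ≤ 512 * ε := by
    refine le_trans (mul_le_mul_of_nonneg_left (pow_le_pow_left₀ hp₀.le p_le 2) ?_) pairs_le
    linarith [Nat.cast_choose_two ℝ G.card, Nat.cast_nonneg (α := ℝ) (G.card.choose 2)]
  have card_filter_le (t : Fin n → ℝ) :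
      ((G.filter fun i => t i = 1).card : ℝ) ≤ max 1 (32 * (√ε / p)) :=
    (Nat.cast_le.2 (Finset.card_filter_le _ _)).trans
      (natCast_le_max_of_mul_sub_one_le hp₀ pairs_mul_le)
  have min_le : min (a ^ 2) ((1 - a) ^ 2) ≤ (1 / 4) ^ 2 := by
    linarith [min_sq_le_of_isClose hp₁ card_mul_le close]
  have error_le : G.card * (G.card - 1) * p ^ 2 + 2 * (546 * ε) ≤ 1604 * ε := by linarith
  rcases min_le_iff.1 min_le with ha | ha
  · have ha := abs_le_of_sq_le_sq ha (by norm_num)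
    exact ⟨_, card_filter_le s, .inl ((close.maxVars_filter hp₁ ha hs).mono error_le)⟩
  · have ha := abs_le_of_sq_le_sq ha (by norm_num)
    have hs_neg (i : Fin n) (hi : i ∈ G) : (-s) i = 1 ∨ (-s) i = -1 :=
      (hs i hi).symm.imp neg_eq_iff_eq_neg.2 (congrArg Neg.neg)
    rw [one_sub_boolFun]
    exact ⟨_, card_filter_le (-s),
      .inr ((close.not_linForm.maxVars_filter hp₁ ha hs_neg).mono error_le)⟩

theorem exists_isClose_maxVars (hp₀ : 0 < p) (hp : p ≤ 1 / 2) {ε : ℝ}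
    {f : Cube n → Bool} {l : Cube n → ℝ} (hl : IsAffine l) (hf : IsClose p ε (boolFun f) l) :
    ∃ S : Finset (Fin n), S.card ≤ max 1 (20000 * (√ε / p)) ∧
      (IsClose p (20000 * ε) (boolFun f) (maxVars S) ∨
        IsClose p (20000 * ε) (1 - boolFun f) (maxVars S)) := by
  have hp₁ : p ∈ Set.Icc 0 1 := ⟨hp₀.le, hp.trans (by norm_num)⟩
  have hε₀ := hf.nonneg hp₁
  rcases le_or_gt ε (1 / 20000) with hε | hε
  · obtain ⟨S, hcard, hS⟩ := exists_isClose_maxVars_of_le hp₀ hp hε hl hf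
    have weaken : 1604 * ε ≤ 20000 * ε := by linarith
    exact ⟨S, hcard.trans (by gcongr; norm_num), hS.imp (·.mono weaken) (·.mono weaken)⟩
  · exact ⟨∅, by simp, .inl ((isClose_boolFun_one hp₁ _ _).mono (by linarith))⟩

/-! ### Complementing the cube -/

theorem muP_compl (x : Cube n) : muP p xᶜ = muP (1 - p) x := by
  rw [muP_eq_prod, muP_eq_prod]
  refine Finset.prod_congr rfl fun i _ => ?_
  rw [Pi.compl_apply]
  cases x i <;> simp

theorem isClose_comp_compl {ε : ℝ} (g h : Cube n → ℝ) :
    IsClose (1 - p) ε (fun x => g xᶜ) (fun x => h xᶜ) ↔ IsClose p ε g h := by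
  have normSq_comp_compl : normSq (1 - p) (fun x => (g - h) xᶜ) = normSq p (g - h) :=
    Fintype.sum_bijective _ compl_bijective _ _ fun x => by rw [muP_compl]
  exact iff_of_eq (congrArg (· ≤ ε) normSq_comp_compl)

theorem IsAffine.comp_compl {l : Cube n → ℝ} (hl : IsAffine l) : IsAffine fun x => l xᶜ := by
  obtain ⟨c₀, c, hc⟩ := hl
  refine ⟨c₀ + ∑ i, c i, fun i => -c i, fun x => ?_⟩
  rw [add_assoc, ← Finset.sum_add_distrib]
  refine (hc xᶜ).trans <| congrArg (c₀ + ·) (Finset.sum_congr rfl fun i _ => ?_)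
  rw [Pi.compl_apply, Bool.compl_eq_bnot, bitVal_not]
  ring

theorem maxVars_compl (S : Finset (Fin n)) (x : Cube n) : maxVars S xᶜ = (1 - minVars S) x := by
  have sup_compl : S.sup xᶜ = !S.inf x := (Finset.compl_inf S x).symm
  rw [Pi.sub_apply, maxVars, boolFun, sup_compl, bitVal_not]
  rfl

theorem exists_isClose_minVars (hp : 1 / 2 ≤ p) (hp₁ : p < 1) {ε : ℝ}
    {f : Cube n → Bool} {l : Cube n → ℝ} (hl : IsAffine l) (hf : IsClose p ε (boolFun f) l) :
    ∃ S : Finset (Fin n), S.card ≤ max 1 (20000 * (√ε / (1 - p))) ∧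
      (IsClose p (20000 * ε) (boolFun f) (minVars S) ∨
        IsClose p (20000 * ε) (1 - boolFun f) (minVars S)) := by
  obtain ⟨S, hcard, hS⟩ := exists_isClose_maxVars (sub_pos.2 hp₁) (by linarith)
    (f := fun x => f xᶜ) hl.comp_compl ((isClose_comp_compl (boolFun f) l).2 hf)
  have minVars_comp_compl : (fun x : Cube n => (1 - minVars S) xᶜ) = maxVars S :=
    funext fun x => by rw [← maxVars_compl, compl_compl]
  have of_compl {g : Cube n → ℝ}
      (hg : IsClose (1 - p) (20000 * ε) (fun x => g xᶜ) (maxVars S)) :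
      IsClose p (20000 * ε) (1 - g) (minVars S) := by
    rw [← minVars_comp_compl, isClose_comp_compl] at hg
    simpa only [sub_sub_cancel] using hg.one_sub
  refine ⟨S, hcard, hS.symm.imp (fun h => ?_) of_compl⟩
  simpa only [sub_sub_cancel] using of_compl (g := 1 - boolFun f) h

end BiasedCube

theorem mainTheorem2 :
    ∃ C : ℝ, 0 < C ∧
      ∀ (n : ℕ) (p ε : ℝ), 0 < p → p < 1 →
        ∀ f : BiasedCube.Cube n → Bool,
          (∃ l : BiasedCube.Cube n → ℝ, BiasedCube.IsAffine l ∧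
            BiasedCube.IsClose p ε (BiasedCube.boolFun f) l) →
          ∃ S : Finset (Fin n),
            (S.card : ℝ) ≤ max 1 (C * (Real.sqrt ε / min p (1 - p))) ∧
            (p ≤ 1 / 2 →
              BiasedCube.IsClose p (C * ε) (BiasedCube.boolFun f) (BiasedCube.maxVars S) ∨
              BiasedCube.IsClose p (C * ε) (1 - BiasedCube.boolFun f) (BiasedCube.maxVars S)) ∧
            (1 / 2 < p →
              BiasedCube.IsClose p (C * ε) (BiasedCube.boolFun f) (BiasedCube.minVars S) ∨
              BiasedCube.IsClose p (C * ε) (1 - BiasedCube.boolFun f) (BiasedCube.minVars S)) := by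
  refine ⟨20000, by norm_num, fun n p ε hp₀ hp₁ f ⟨l, hl, hf⟩ => ?_⟩
  rcases le_or_gt p (1 / 2) with hp | hp
  · obtain ⟨S, hcard, hS⟩ := BiasedCube.exists_isClose_maxVars hp₀ hp hl hf
    rw [min_eq_left (by linarith)]
    exact ⟨S, hcard, fun _ => hS, fun hp' => absurd hp (not_le.2 hp')⟩
  · obtain ⟨S, hcard, hS⟩ := BiasedCube.exists_isClose_minVars hp.le hp₁ hl hf
    rw [min_eq_right (by linarith)]
    exact ⟨S, hcard, fun hp' => absurd hp' (not_le.2 hp), fun _ => hS⟩
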